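/- Let $\mathbb F$ be a finite field of prime order and let $d, D$ be integers with $0 \le d, D < |\mathbb F|$. Definitions. For $P:\mathbb F^n\to\mathbb F$ and $h\in\mathbb F^n$ put $D_hP(x) := P(x+h)-P(x)$. For $e\ge 0$ let $\mathcal P_e(\mathbb F^n)$ be the space of polynomials of degree at most $e$, that is, of functions $P:\mathbb F^n\to\mathbb F$ with $D_{h_1}\cdots D_{h_{e+1}}P=0$ for all $h_1,\dots,h_{e+1}\in\mathbb F^n$. The degree $e$ rank $\mathrm{rank}_e(P)$ is the least integer $k\ge 0$ for which there are $Q_1,\dots,Q_k\in\mathcal P_e(\mathbb F^n)$ and a function $B:\mathbb F^k\to\mathbb F$ with $P=B(Q_1,\dots,Q_k)$ (and $\infty$ if there is no such $k$). A factor of degree $d$ on $\mathbb F^n$ is a finite family $\mathcal F=(P_{i,j})_{1\le i\le d,\,1\le j\le M_i}$ with $M_i\ge 0$ and $P_{i,j}\in\mathcal P_i(\mathbb F^n)$; its dimension is $\dim(\mathcal F)=M_1+\dots+M_d$, and $\sigma(\mathcal F)$ is the $\sigma$-algebra on $\mathbb F^n$ whose atoms are the non-empty joint level sets $\{x : P_{i,j}(x)=c_{i,j}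 \text{ for all } i,j\}$. A growth function is a non-decreasing function $F:\mathbb Z_{\ge 0}\to\mathbb R_{\ge 0}$. The factor $\mathcal F$ is $F$-regular if $$\mathrm{rank}_{i-1}\Big(\sum_{j=1}^{M_i}c_jP_{i,j}\Big)\ \ge\ F(\dim(\mathcal F))$$ for all $1\le i\le d$ and all $c_1,\dots,c_{M_i}\in\mathbb F$ that are not all zero. An $\mathcal F$-monomial of $\mathcal F$-degree $e$ is a product $\prod_{j=1}^J Q_j$ (with $J\ge 0$) in which each $Q_j$ lies in the linear span of $P_{d_j,1},\dots,P_{d_j,M_{d_j}}$ for some $d_j\in\{1,\dots,d\}$, and $d_1+\dots+d_J=e$. A function has $\mathcal F$-degree at most $D$ if it is an $\mathbb F$-linear combination of $\mathcal F$-monomials of $\mathcal F$-degrees at most $D$. Theorem (degree and $\mathcal F$-degree agree for regular factors). There is a growth function $F$, depending only on $\mathbb F$, $d$ and $D$, with the following property. For every $n\ge 0$, every $F$-regular factor $\mathcal F$ of degree $d$ on $\mathbb F^n$, and every $P\in\mathcal P_D(\mathbb F^n)$ that is measurable with respect to $\sigma(\mathcal F)$, the polynomial $P$ has $\mathcal F$-degree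 at most $D$. -/

import Mathlib

open scoped NNReal ENNReal

/-- The iterated additive derivative `D_{h_1} ⋯ D_{h_m} P` along the list `[h_1, …, h_m]` of shifts,
where `fwdDiff h P x = P (x + h) - P x`. -/
def iteratedDiff {V G : Type*} [AddCommMonoid V] [AddCommGroup G] (l : List V) (P : V → G) : V → G :=
  l.foldr fwdDiff P

/-- `P : 𝔽ⁿ → 𝔽` is a polynomial of degree at most `d` (an element of `𝒫_d(𝔽ⁿ)`): all its derivatives
of order `d + 1` vanish identically. -/
def IsPolyOfDegreeLE {p n : ℕ} (d : ℕ) (P : (Fin n → ZMod p) → ZMod p) : Prop :=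
  ∀ l : List (Fin n → ZMod p), l.length = d + 1 → iteratedDiff l P = 0

/-- `P = B(Q_1, …, Q_k)` for some polynomials `Q_1, …, Q_k` of degree at most `d` and some function
`B : 𝔽ᵏ → 𝔽`. -/
def HasRepresentation {p n : ℕ} (d k : ℕ) (P : (Fin n → ZMod p) → ZMod p) : Prop :=
  ∃ (Q : Fin k → (Fin n → ZMod p) → ZMod p) (B : (Fin k → ZMod p) → ZMod p),
    (∀ j, IsPolyOfDegreeLE d (Q j)) ∧ ∀ x, P x = B fun j => Q j x

/-- The degree `d` rank `rank_d(P)`: the least `k` such that `P` is a function of `k` polynomials of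
degree at most `d`; it is `⊤` if there is no such `k`. -/
noncomputable def degreeRank {p n : ℕ} (d : ℕ) (P : (Fin n → ZMod p) → ZMod p) : ℕ∞ :=
  ⨅ (k : ℕ) (_ : HasRepresentation d k P), (k : ℕ∞)

/-- A factor of degree `d` on `𝔽ⁿ`, `𝔽 = ZMod p`: a family of polynomials `P_{i,j}`, `1 ≤ i ≤ d`,
`1 ≤ j ≤ M_i`, where `P_{i,j}` has degree at most `i`.
The index `i : Fin d` stands for the degree `i + 1`. -/
structure PolyFactor (p n d : ℕ) where
  /-- The number of polynomials in the part of degree `i + 1`. -/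
  M : Fin d → ℕ
  /-- The polynomials. -/
  poly : (i : Fin d) → Fin (M i) → (Fin n → ZMod p) → ZMod p
  /-- The polynomials with first index `i` have degree at most `i + 1`. -/
  degree_le : ∀ (i : Fin d) (j : Fin (M i)), IsPolyOfDegreeLE ((i : ℕ) + 1) (poly i j)

namespace PolyFactor

variable {p n d : ℕ}

/-- The dimension `M_1 + ⋯ + M_d`. -/
def dim (𝓕 : PolyFactor p n d) : ℕ := ∑ i, 𝓕.M i

/-- The evaluation map `Φ` into the configuration space. -/
def evalMap (𝓕 : PolyFactor p n d) (x : Fin n → ZMod p) : (i : Fin d) → Fin (𝓕.M i) → ZMod p :=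
  fun i j => 𝓕.poly i j x

/-- The `σ`-algebra `σ(𝓕)`, whose sets are the unions of atoms `{x | Φ x = c}`. -/
@[reducible] def sigmaAlgebra (𝓕 : PolyFactor p n d) : MeasurableSpace (Fin n → ZMod p) :=
  MeasurableSpace.comap 𝓕.evalMap ⊤

/-- A function is `σ(𝓕)`-measurable if and only if it is constant on atoms. -/
theorem measurable_iff (𝓕 : PolyFactor p n d) (P : (Fin n → ZMod p) → ZMod p) :
    @Measurable _ _ 𝓕.sigmaAlgebra ⊤ P ↔
      ∀ x y, 𝓕.evalMap x = 𝓕.evalMap y → P x = P y := by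
  constructor
  · intro h x y hxy
    obtain ⟨S, -, hS⟩ := @h {P y} trivial
    have hy : y ∈ 𝓕.evalMap ⁻¹' S := by rw [hS]; rfl
    have hx : x ∈ 𝓕.evalMap ⁻¹' S := by
      change 𝓕.evalMap x ∈ S
      rw [hxy]; exact hy
    rw [hS] at hx
    exact hx
  · intro h S _
    refine ⟨𝓕.evalMap '' (P ⁻¹' S), trivial, ?_⟩
    ext x
    constructor
    · rintro ⟨y, hy, hyx⟩
      change P x ∈ S
      rw [← h y x hyx]; exact hy
    · intro hx
      exact ⟨x, hx, rfl⟩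

/-- `F`-regularity: for each degree `i`, every linear combination of `P_{i,1}, …, P_{i,M_i}` whose
coefficients are not all zero has degree `i - 1` rank at least `F(dim 𝓕)`. -/
def IsRegular (𝓕 : PolyFactor p n d) (F : ℕ → ℝ≥0) : Prop :=
  ∀ (i : Fin d) (c : Fin (𝓕.M i) → ZMod p), c ≠ 0 →
    (F 𝓕.dim : ℝ≥0∞) ≤ (degreeRank (i : ℕ) (∑ j, c j • 𝓕.poly i j) : ℕ∞)

/-- `g` is an `𝓕`-monomial of `𝓕`-degree `e`: a product of functions `Q_1, …, Q_J` with `Q_j` in the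
span of the degree `d_j` part of `𝓕`, where `d_1 + ⋯ + d_J = e`. -/
def IsMonomial (𝓕 : PolyFactor p n d) (e : ℕ) (g : (Fin n → ZMod p) → ZMod p) : Prop :=
  ∃ (J : ℕ) (δ : Fin J → Fin d) (Q : Fin J → (Fin n → ZMod p) → ZMod p),
    (∀ j, Q j ∈ Submodule.span (ZMod p) (Set.range (𝓕.poly (δ j)))) ∧
      g = ∏ j, Q j ∧ ∑ j, ((δ j : ℕ) + 1) = e

/-- `P` has `𝓕`-degree at most `D`: it is a linear combination of `𝓕`-monomials of `𝓕`-degree at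
most `D`. -/
def HasFactorDegreeLE (𝓕 : PolyFactor p n d) (D : ℕ) (P : (Fin n → ZMod p) → ZMod p) : Prop :=
  P ∈ Submodule.span (ZMod p) {g | ∃ e ≤ D, 𝓕.IsMonomial e g}

end PolyFactor

/-! Split off the polynomials `y i` of the highest degree `n` in the factor, and write `P` as a
reduced polynomial `∑ q_a y^a` whose coefficients are functions of the lower-degree ones. Give `q_a
y^a` the weight `deg q_a + n|a|`. High rank prevents cancellation among terms of top weight: if all
weights are at most `e` and the sum has degree at most `e - 1`, then all weights are at most `e - 1`
(`weightedLE_of_eval_mem`). Descending from an a priori bound to `D` gives `deg q_a ≤ D - n|a|`, and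
induction on the degrees present in the factor treats each `q_a` (`mem_factorDegreeLE`).

Non-cancellation is proved by differentiating. Up to degree `e - 2`, `D_h` obeys the Leibniz rule
(`fwdDiff_eval_sub_mem`), so by induction the formal derivative has weight at most `e - 2`. Take a
bad coefficient `q_b` with `|b|` maximal. If its allowed degree is positive, all its derivatives
drop in degree, hence so does `q_b`. If that degree is zero and `b ≠ 0`, lowering one exponent of
`b` to get `b'` yields a nonzero `c` with `q_{b'} + ∑ c_i y_i` of degree below `n`; then `∑ c_i y_i`
is a function of few polynomials of lower degree, against the rank hypothesis. -/

/-! ### The degree filtration on functions, indexed by the integers. -/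

section Filtration

variable {K V : Type*} [CommRing K] [AddCommGroup V]

theorem iteratedDiff_cons (h : V) (l : List V) (f : V → K) :
    iteratedDiff (h :: l) f = fwdDiff h (iteratedDiff l f) := rfl

theorem iteratedDiff_concat (l : List V) (h : V) (f : V → K) :
    iteratedDiff (l ++ [h]) f = iteratedDiff l (fwdDiff h f) := by
  simp [iteratedDiff]

theorem iteratedDiff_add (l : List V) (f g : V → K) :
    iteratedDiff l (f + g) = iteratedDiff l f + iteratedDiff l g := by
  induction l with
  | nil => rfl
  | cons h l ih => rw [iteratedDiff_cons, ih, fwdDiff_add]; rfl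

theorem iteratedDiff_smul (l : List V) (c : K) (f : V → K) :
    iteratedDiff l (c • f) = c • iteratedDiff l f := by
  induction l with
  | nil => rfl
  | cons h l ih => rw [iteratedDiff_cons, ih, fwdDiff_const_smul]; rfl

/-- The functions of degree at most `e`; for negative `e` only the zero function. -/
def polyLE (K V : Type*) [CommRing K] [AddCommGroup V] (e : ℤ) : Submodule K (V → K) where
  carrier := {f | ∀ l : List V, e < l.length → iteratedDiff l f = 0}
  zero_mem' l _ := by simpa using iteratedDiff_smul l (0 : K) (0 : V → K)
  add_mem' hf hg l hl := by rw [iteratedDiff_add, hf l hl, hg l hl, add_zero]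
  smul_mem' c f hf l hl := by rw [iteratedDiff_smul, hf l hl, smul_zero]

theorem polyLE_mono : Monotone (polyLE K V) := fun _ _ hab _ hf l hl => hf l (hab.trans_lt hl)

/-- With integer indices, `e - 1` and `e - n * |a|` are never truncated; this lemma disposes of the
negative values. -/
theorem eq_zero_of_mem_polyLE {e : ℤ} (he : e < 0) {f : V → K} (hf : f ∈ polyLE K V e) : f = 0 :=
  hf [] (by simpa using he)

theorem fwdDiff_mem_polyLE {e : ℤ} {f : V → K} (hf : f ∈ polyLE K V e) (h : V) :
    fwdDiff h f ∈ polyLE K V (e - 1) := fun l hl => by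
  rw [← iteratedDiff_concat]
  exact hf _ (by simp; omega)

/-- The bound `0 ≤ e` excludes nonzero constants, whose derivatives all vanish. -/
theorem mem_polyLE_of_fwdDiff {e : ℤ} (he : 0 ≤ e) {f : V → K}
    (hf : ∀ h, fwdDiff h f ∈ polyLE K V (e - 1)) : f ∈ polyLE K V e := fun l hl => by
  rcases l.eq_nil_or_concat with rfl | ⟨l, h, rfl⟩
  · simp at hl; omega
  · rw [List.concat_eq_append, iteratedDiff_concat]
    exact hf h l (by simp at hl; omega)

theorem const_mem_polyLE {e : ℤ} (he : 0 ≤ e) (c : K) : (fun _ => c) ∈ polyLE K V e :=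
  mem_polyLE_of_fwdDiff he fun h => by
    have : fwdDiff h (fun _ : V => c) = 0 := by ext; simp [fwdDiff]
    rw [this]; exact zero_mem _

theorem eq_const_of_mem_polyLE_zero {f : V → K} (hf : f ∈ polyLE K V 0) (x : V) : f x = f 0 := by
  have := congrFun (eq_zero_of_mem_polyLE (by norm_num) (fwdDiff_mem_polyLE hf x)) 0
  simpa [fwdDiff, sub_eq_zero] using this

theorem fwdDiff_mul_eq (h : V) (f g : V → K) :
    fwdDiff h (f * g) = fwdDiff h f * g + f * fwdDiff h g + fwdDiff h f * fwdDiff h g := by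
  ext x
  simp only [fwdDiff, Pi.mul_apply, Pi.add_apply]
  ring

theorem mul_mem_polyLE {a b : ℤ} {f g : V → K} (hf : f ∈ polyLE K V a) (hg : g ∈ polyLE K V b) :
    f * g ∈ polyLE K V (a + b) := by
  obtain ⟨N, hN⟩ : ∃ N : ℕ, a + b < N := ⟨(a + b + 1).toNat, by omega⟩
  induction N generalizing a b f g with
  | zero =>
    rcases lt_or_ge a 0 with ha | ha
    · rw [eq_zero_of_mem_polyLE ha hf, zero_mul]; exact zero_mem _
    · rw [eq_zero_of_mem_polyLE (by push_cast at hN; omega) hg, mul_zero]; exact zero_mem _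
  | succ N ih =>
    rcases lt_or_ge a 0 with ha | ha
    · rw [eq_zero_of_mem_polyLE ha hf, zero_mul]; exact zero_mem _
    rcases lt_or_ge b 0 with hb | hb
    · rw [eq_zero_of_mem_polyLE hb hg, mul_zero]; exact zero_mem _
    push_cast at hN
    refine mem_polyLE_of_fwdDiff (by omega) fun h => ?_
    have hf' := fwdDiff_mem_polyLE hf h
    have hg' := fwdDiff_mem_polyLE hg h
    rw [fwdDiff_mul_eq]
    refine add_mem (add_mem ?_ ?_) ?_
    · exact polyLE_mono (by omega) (ih hf' hg (by omega))
    · exact polyLE_mono (by omega) (ih hf hg' (by omega))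
    · exact polyLE_mono (by omega) (ih hf' hg' (by omega))

/-- Translation by `h`, as a ring homomorphism. -/
def shiftHom (h : V) : (V → K) →+* (V → K) where
  toFun f x := f (x + h)
  map_one' := rfl
  map_mul' _ _ := rfl
  map_zero' := rfl
  map_add' _ _ := rfl

theorem shiftHom_apply (h : V) (f : V → K) (x : V) : shiftHom h f x = f (x + h) := rfl

theorem shiftHom_eq (h : V) (f : V → K) : shiftHom h f = f + fwdDiff h f := by
  ext x
  simp [fwdDiff, shiftHom_apply]

theorem shiftHom_sub (h : V) (f : V → K) : shiftHom h f - f = fwdDiff h f := rfl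

theorem shiftHom_mem_polyLE {e : ℤ} {f : V → K} (hf : f ∈ polyLE K V e) (h : V) :
    shiftHom h f ∈ polyLE K V e := by
  rw [shiftHom_eq]
  exact add_mem hf (polyLE_mono (by omega) (fwdDiff_mem_polyLE hf h))

end Filtration

theorem isPolyOfDegreeLE_iff {p n : ℕ} {d : ℕ} {P : (Fin n → ZMod p) → ZMod p} :
    IsPolyOfDegreeLE d P ↔ P ∈ polyLE (ZMod p) (Fin n → ZMod p) d := by
  refine ⟨fun hP l => ?_, fun hP l hl => hP l (by omega)⟩
  induction l with
  | nil => intro hl; simp at hl; omega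
  | cons h l ih =>
    intro hl
    rcases eq_or_lt_of_le (show d + 1 ≤ (h :: l).length by exact_mod_cast hl) with h1 | h1
    · exact hP _ h1.symm
    · rw [iteratedDiff_cons, ih (by simp at h1; exact_mod_cast h1)]
      ext; simp [fwdDiff]

/-! ### Polynomials in the `y i` with function coefficients, graded by weight. -/

section Weighted

open MvPolynomial

variable {K V σ : Type*} [CommRing K]

/-- The coefficient of `X ^ a` lies in `U (e - n * |a|)`. -/
def WeightedLE (U : ℤ → Submodule K (V → K)) (n e : ℤ) (q : MvPolynomial σ (V → K)) : Prop :=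
  ∀ a : σ →₀ ℕ, q.coeff a ∈ U (e - n * (a.degree : ℕ))

theorem WeightedLE.mono {U : ℤ → Submodule K (V → K)} (hU : Monotone U) {n e e' : ℤ} (h : e ≤ e')
    {q : MvPolynomial σ (V → K)} (hq : WeightedLE U n e q) : WeightedLE U n e' q :=
  fun a => hU (by omega) (hq a)

theorem WeightedLE.of_mul_X {U : ℤ → Submodule K (V → K)} {n e : ℤ} {q : MvPolynomial σ (V → K)}
    {i : σ} (hq : WeightedLE U n e (q * X i)) : WeightedLE U n (e - n) q := fun a => by
  have := hq (a + Finsupp.single i 1)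
  rw [coeff_mul_X, map_add, Finsupp.degree_single] at this
  convert this using 2
  push_cast
  ring

theorem WeightedLE.monomial {U : ℤ → Submodule K (V → K)} {n e : ℤ} {q : MvPolynomial σ (V → K)}
    (hq : WeightedLE U n e q) (a : σ →₀ ℕ) : WeightedLE U n e (monomial a (q.coeff a)) :=
  fun b => by
    classical
    rw [coeff_monomial]
    split_ifs with hab
    · rw [← hab]; exact hq a
    · exact zero_mem _

/-- `U` is kept general because the lemma serves both for the degree filtration and for the
filtration by `𝓕`-degree. -/
theorem WeightedLE.eval_mem {U : ℤ → Submodule K (V → K)} {n e : ℤ} {y : σ → V → K}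
    (hU : ∀ e f i, f ∈ U e → f * y i ∈ U (e + n))
    {q : MvPolynomial σ (V → K)} (hq : WeightedLE U n e q) : eval y q ∈ U e := by
  have key : ∀ (a : σ →₀ ℕ) (c : V → K) (e : ℤ), WeightedLE U n e (MvPolynomial.monomial a c) →
      eval y (MvPolynomial.monomial a c) ∈ U e := by
    refine induction_on_monomial (fun c e hc => ?_) fun q i ih e hq => ?_
    · simpa using hc 0
    · rw [map_mul, eval_X]
      simpa using hU _ _ i (ih _ hq.of_mul_X)
  rw [← support_sum_monomial_coeff q, map_sum]
  exact sum_mem fun a _ => key a _ e (hq.monomial a)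

variable [AddCommGroup V]

/-- The formal derivative of `q` in direction `h`, to first order in the variables, which stand for
the functions `y i`. -/
noncomputable def formalDiff [Fintype σ] (h : V) (y : σ → V → K) (q : MvPolynomial σ (V → K)) :
    MvPolynomial σ (V → K) :=
  map (shiftHom h) q - q + ∑ i, pderiv i q * C (fwdDiff h (y i))

theorem formalDiff_add [Fintype σ] (h : V) (y : σ → V → K) (q q' : MvPolynomial σ (V → K)) :
    formalDiff h y (q + q') = formalDiff h y q + formalDiff h y q' := by
  simp only [formalDiff, map_add, add_mul, Finset.sum_add_distrib]
  ring

theorem formalDiff_mul_X [Fintype σ] (h : V) (y : σ → V → K) (q : MvPolynomial σ (V → K)) (i : σ) :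
    formalDiff h y (q * X i) = formalDiff h y q * X i + q * C (fwdDiff h (y i)) := by
  classical
  have : ∀ j, pderiv j (q * X i) * C (fwdDiff h (y j)) =
      pderiv j q * C (fwdDiff h (y j)) * X i +
        if j = i then q * C (fwdDiff h (y i)) else 0 := fun j => by
    rw [pderiv_mul, pderiv_X, add_mul]
    congr 1
    · ring
    · rcases eq_or_ne j i with rfl | hji
      · simp
      · simp [hji, hji.symm]
  simp only [formalDiff, map_mul, map_X, this, Finset.sum_add_distrib, Finset.sum_ite_eq',
    Finset.mem_univ, if_true, add_mul, Finset.sum_mul]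
  ring

theorem coeff_formalDiff [Fintype σ] (h : V) (y : σ → V → K) (q : MvPolynomial σ (V → K))
    (b : σ →₀ ℕ) : (formalDiff h y q).coeff b = fwdDiff h (q.coeff b) +
      ∑ i, q.coeff (b + Finsupp.single i 1) * (b i + 1) * fwdDiff h (y i) := by
  simp only [formalDiff, coeff_add, coeff_sub, coeff_map, coeff_sum, mul_comm _ (C _), coeff_C_mul,
    coeff_pderiv, shiftHom_sub, mul_comm _ (fwdDiff h (y _))]

theorem WeightedLE.formalDiff [Fintype σ] {n e : ℤ} {y : σ → V → K}
    (hy : ∀ i, y i ∈ polyLE K V n) {q : MvPolynomial σ (V → K)}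
    (hq : WeightedLE (polyLE K V) n e q) (h : V) :
    WeightedLE (polyLE K V) n (e - 1) (formalDiff h y q) := fun b => by
  rw [coeff_formalDiff]
  refine add_mem (polyLE_mono (by omega) (fwdDiff_mem_polyLE (hq b) h)) (sum_mem fun i _ => ?_)
  have h1 := hq (b + Finsupp.single i 1)
  rw [map_add, Finsupp.degree_single] at h1
  have h2 : ((b i : V → K) + 1) ∈ polyLE K V 0 := by
    convert const_mem_polyLE (V := V) le_rfl ((b i : K) + 1) using 1
    ext; simp
  refine polyLE_mono (le_of_eq ?_)
    (mul_mem_polyLE (mul_mem_polyLE h1 h2) (fwdDiff_mem_polyLE (hy i) h))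
  push_cast
  ring

/-- The terms omitted from `formalDiff` contain at least two differenced factors, so each loses at
least two degrees. -/
theorem fwdDiff_eval_sub_mem [Fintype σ] {n e : ℤ} {y : σ → V → K} (hy : ∀ i, y i ∈ polyLE K V n)
    {q : MvPolynomial σ (V → K)} (hq : WeightedLE (polyLE K V) n e q) (h : V) :
    fwdDiff h (eval y q) - eval y (formalDiff h y q) ∈ polyLE K V (e - 2) := by
  have hU : ∀ e f i, f ∈ polyLE K V e → f * y i ∈ polyLE K V (e + n) :=
    fun e f i hf => mul_mem_polyLE hf (hy i)
  have key : ∀ (a : σ →₀ ℕ) (c : V → K) (e : ℤ),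
      WeightedLE (polyLE K V) n e (MvPolynomial.monomial a c) →
      fwdDiff h (eval y (MvPolynomial.monomial a c)) -
        eval y (_root_.formalDiff h y (MvPolynomial.monomial a c)) ∈ polyLE K V (e - 2) := by
    refine induction_on_monomial (fun c e hc => ?_) fun q i ih e hq => ?_
    · simp [_root_.formalDiff, shiftHom_sub]
    · have h1 := ih _ hq.of_mul_X
      have h2 := fwdDiff_mem_polyLE (hq.of_mul_X.eval_mem hU) h
      have h3 : fwdDiff h (eval y (q * X i)) - eval y (_root_.formalDiff h y (q * X i)) =
          (fwdDiff h (eval y q) - eval y (_root_.formalDiff h y q)) * y i +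
            fwdDiff h (eval y q) * fwdDiff h (y i) := by
        rw [formalDiff_mul_X, map_mul, eval_X, fwdDiff_mul_eq, map_add, map_mul, map_mul, eval_X,
          eval_C]
        ring
      rw [h3]
      refine add_mem (polyLE_mono (by omega) (hU _ _ i h1))
        (polyLE_mono (by omega) (mul_mem_polyLE h2 (fwdDiff_mem_polyLE (hy i) h)))
  have hadd : ∀ s : Finset (σ →₀ ℕ),
      fwdDiff h (eval y (∑ a ∈ s, MvPolynomial.monomial a (q.coeff a))) -
        eval y (_root_.formalDiff h y (∑ a ∈ s, MvPolynomial.monomial a (q.coeff a))) ∈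
          polyLE K V (e - 2) := fun s => by
    classical
    induction s using Finset.induction_on with
    | empty =>
      convert (polyLE K V (e - 2)).zero_mem using 1
      ext
      simp [_root_.formalDiff, fwdDiff]
    | insert a s ha ih =>
      rw [Finset.sum_insert ha, formalDiff_add, map_add, map_add, fwdDiff_add, add_sub_add_comm]
      exact add_mem (key a _ e (hq.monomial a)) ih
  simpa only [support_sum_monomial_coeff] using hadd q.support

end Weighted

/-! ### Functional dependence on a set of functions. -/

section Determined

variable {K V : Type*}

/-- `f` is a function of the functions in `S`. -/
def IsDeterminedBy (S : Set (V → K)) (f : V → K) : Prop :=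
  ∀ x x', (∀ g ∈ S, g x = g x') → f x = f x'

theorem IsDeterminedBy.mono {S T : Set (V → K)} (hST : S ⊆ T) {f : V → K}
    (hf : IsDeterminedBy S f) : IsDeterminedBy T f :=
  fun x x' h => hf x x' fun g hg => h g (hST hg)

theorem isDeterminedBy_of_mem {S : Set (V → K)} {f : V → K} (hf : f ∈ S) : IsDeterminedBy S f :=
  fun _ _ h => h f hf

theorem IsDeterminedBy.const (S : Set (V → K)) (c : K) : IsDeterminedBy S fun _ => c :=
  fun _ _ _ => rfl

variable [CommRing K] {S : Set (V → K)} {f g : V → K}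

theorem IsDeterminedBy.add (hf : IsDeterminedBy S f) (hg : IsDeterminedBy S g) :
    IsDeterminedBy S (f + g) := fun x x' h => by simp [hf x x' h, hg x x' h]

theorem IsDeterminedBy.sub (hf : IsDeterminedBy S f) (hg : IsDeterminedBy S g) :
    IsDeterminedBy S (f - g) := fun x x' h => by simp [hf x x' h, hg x x' h]

theorem IsDeterminedBy.mul (hf : IsDeterminedBy S f) (hg : IsDeterminedBy S g) :
    IsDeterminedBy S (f * g) := fun x x' h => by simp [hf x x' h, hg x x' h]

theorem IsDeterminedBy.sum {ι : Type*} {s : Finset ι} {f : ι → V → K}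
    (hf : ∀ i ∈ s, IsDeterminedBy S (f i)) : IsDeterminedBy S (∑ i ∈ s, f i) := fun x x' h => by
  simp only [Finset.sum_apply]
  exact Finset.sum_congr rfl fun i hi => hf i hi x x' h

theorem IsDeterminedBy.shiftHom [AddCommGroup V] (hf : IsDeterminedBy S f) (h : V) :
    IsDeterminedBy (shiftHom h '' S) (shiftHom h f) := fun x x' hx =>
  hf _ _ fun g hg => hx _ ⟨g, hg, rfl⟩

end Determined

/-! ### Reduced expansions. -/

section Expansion

open MvPolynomial

variable {K V σ : Type*} [Field K] [Fintype K] [Fintype σ]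

/-- Lagrange interpolation in the values of `y` only: sum over `u` the function frozen at `y = u`
times the indicator polynomial of `u`, whose exponents are below `|K|`. -/
theorem exists_reduced_eval_eq {S : Set (V → K)} {y : σ → V → K} {f : V → K}
    (hf : IsDeterminedBy (S ∪ Set.range y) f) :
    ∃ q : MvPolynomial σ (V → K), eval y q = f ∧ (∀ a, IsDeterminedBy S (q.coeff a)) ∧
      ∀ a, q.coeff a ≠ 0 → ∀ i, a i < Fintype.card K := by
  classical
  let Φ : V → (S → K) × (σ → K) := fun x => (fun g => g.1 x, fun i => y i x)
  obtain ⟨B, hB⟩ : ∃ B : (S → K) × (σ → K) → K, ∀ x, B (Φ x) = f x := by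
    refine ⟨Function.extend Φ f fun _ => 0, fun x => Function.FactorsThrough.extend_apply ?_ _ x⟩
    intro x x' hx
    refine hf x x' ?_
    rintro g (hg | ⟨i, rfl⟩)
    · exact congrFun (congrArg Prod.fst hx) ⟨g, hg⟩
    · exact congrFun (congrArg Prod.snd hx) i
  let c : (σ → K) → V → K := fun u x => B ((Φ x).1, u)
  let q : MvPolynomial σ (V → K) := ∑ u, C (c u) * map (algebraMap K (V → K)) (indicator u)
  have hq : ∀ a, q.coeff a = ∑ u, c u * algebraMap K (V → K) ((indicator u).coeff a) := fun a => by
    simp [q, coeff_sum, coeff_C_mul, coeff_map]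
  refine ⟨q, ?_, fun a => ?_, fun a ha i => ?_⟩
  · ext x
    have h1 : ∀ u : σ → K, (eval y (map (algebraMap K (V → K)) (indicator u))) x =
        eval (fun i => y i x) (indicator u) := fun u => by
      have := eval₂_comp_left (Pi.evalRingHom (fun _ : V => K) x) (algebraMap K (V → K)) y
        (indicator u)
      rw [eval_map]
      exact this
    simp only [q, map_sum, map_mul, eval_C, Finset.sum_apply, Pi.mul_apply, h1]
    rw [Finset.sum_eq_single (fun i => y i x)]
    · rw [eval_indicator_apply_eq_one, mul_one, ← hB x]
    · intro u _ hu
      rw [eval_indicator_apply_eq_zero _ _ hu.symm, mul_zero]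
    · simp
  · rw [hq]
    refine IsDeterminedBy.sum fun u _ => IsDeterminedBy.mul (fun x x' hx => ?_)
      (IsDeterminedBy.const S _)
    simp only [c, Φ]
    congr 2
    ext g
    exact hx g.1 g.2
  · by_contra hai
    refine ha ?_
    rw [hq]
    refine Finset.sum_eq_zero fun u _ => ?_
    have : (indicator u).coeff a = 0 := by
      by_contra h0
      have := (mem_restrictDegree σ _ _).1 (indicator_mem_restrictDegree u) a (mem_support_iff.2 h0) i
      have := Fintype.card_pos (α := K)
      omega
    rw [this, map_zero, mul_zero]

theorem degree_le_of_forall_lt {σ : Type*} [Fintype σ] {k : ℕ} {a : σ →₀ ℕ} (ha : ∀ i, a i < k) :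
    a.degree ≤ Fintype.card σ * (k - 1) := by
  rw [Finsupp.degree_eq_sum]
  calc ∑ i, a i ≤ ∑ _i : σ, (k - 1) := Finset.sum_le_sum fun i _ => by have := ha i; omega
    _ = _ := by simp

/-- With `S = ∅` the coefficients of the reduced expansion are constants, so only the exponents
contribute to the degree. -/
theorem mem_polyLE_of_isDeterminedBy [AddCommGroup V] {n : ℕ} {y : σ → V → K}
    (hy : ∀ i, y i ∈ polyLE K V n) {f : V → K} (hf : IsDeterminedBy (Set.range y) f) :
    f ∈ polyLE K V (n * (Fintype.card σ * (Fintype.card K - 1) : ℕ)) := by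
  obtain ⟨q, rfl, hq, hred⟩ := exists_reduced_eval_eq (S := ∅) (by simpa using hf)
  refine WeightedLE.eval_mem (n := n) (fun e f i hf => mul_mem_polyLE hf (hy i)) fun a => ?_
  by_cases ha : q.coeff a = 0
  · rw [ha]; exact zero_mem _
  have h1 : q.coeff a = fun _ => q.coeff a 0 := by
    ext x; exact hq a x 0 (by simp)
  rw [h1]
  refine const_mem_polyLE ?_ _
  rw [← mul_sub]
  have := degree_le_of_forall_lt (hred a ha)
  exact mul_nonneg (by positivity) (by omega)

end Expansion

/-! ### High rank forbids cancellation in top weight. -/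

section Regular

open MvPolynomial

variable {p : ℕ} [Fact p.Prime] {V σ : Type*} [AddCommGroup V] [Fintype σ]

/-- Controls complexity: one differentiation takes `k` determining functions to at most `2 * k +
|σ|`. -/
theorem isDeterminedBy_coeff_formalDiff {S : Set (V → ZMod p)} {y : σ → V → ZMod p}
    {q : MvPolynomial σ (V → ZMod p)} (hq : ∀ a, IsDeterminedBy S (q.coeff a)) (h : V)
    (a : σ →₀ ℕ) :
    IsDeterminedBy (S ∪ shiftHom h '' S ∪ Set.range fun i => fwdDiff h (y i))
      ((formalDiff h y q).coeff a) := by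
  have hS : ∀ a, IsDeterminedBy (S ∪ shiftHom h '' S ∪ Set.range fun i => fwdDiff h (y i))
      (q.coeff a) := fun a => (hq a).mono (by grind)
  rw [coeff_formalDiff]
  refine IsDeterminedBy.add ?_ (IsDeterminedBy.sum fun i _ => ?_)
  · rw [← shiftHom_sub]
    exact (((hq a).shiftHom h).mono (by grind)).sub (hS a)
  · refine ((hS _).mul ?_).mul (isDeterminedBy_of_mem (Or.inr ⟨i, rfl⟩))
    exact fun x x' _ => by simp

theorem coeff_formalDiff_of_reduced {k : ℕ} {y : σ → V → ZMod p}
    {q : MvPolynomial σ (V → ZMod p)} (hq : ∀ a, q.coeff a ≠ 0 → ∀ i, a i < k) (h : V)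
    (a : σ →₀ ℕ) (ha : (formalDiff h y q).coeff a ≠ 0) (i : σ) : a i < k := by
  classical
  by_contra hi
  refine ha ?_
  have h0 : ∀ b : σ →₀ ℕ, k ≤ b i → q.coeff b = 0 := fun b hb => by
    by_contra h0
    exact absurd (hq b h0 i) (by omega)
  rw [coeff_formalDiff, h0 a (by omega)]
  have : ∀ j, q.coeff (a + Finsupp.single j 1) = 0 := fun j => h0 _ (by simp; omega)
  simp only [this, zero_mul, Finset.sum_const_zero, add_zero]
  ext; simp [fwdDiff]

/-- If no nontrivial linear combination of the `y i`, of degree at most `n`, is a function of few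
polynomials of lower degree, then there is no nontrivial cancellation among top degree terms in
reduced polynomials in the `y i` whose coefficients are functions of few polynomials of lower
degree. -/
theorem weightedLE_of_eval_mem {n : ℤ} (hn : 1 ≤ n) {y : σ → V → ZMod p}
    (hy : ∀ i, y i ∈ polyLE (ZMod p) V n) {L : ℕ}
    (hL : ∀ c : σ → ZMod p, c ≠ 0 → ∀ S : Finset (V → ZMod p),
      (∀ g ∈ S, g ∈ polyLE (ZMod p) V (n - 1)) →
        IsDeterminedBy (S : Set (V → ZMod p)) (∑ i, c i • y i) → L < S.card)
    (E k : ℕ) (hE : (k + 1 + Fintype.card σ) * 3 ^ E ≤ L) {e : ℤ} (he : e < E)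
    {S : Finset (V → ZMod p)} (hcard : S.card ≤ k) (hS : ∀ g ∈ S, g ∈ polyLE (ZMod p) V (n - 1))
    {q : MvPolynomial σ (V → ZMod p)} (hq : WeightedLE (polyLE (ZMod p) V) n e q)
    (hred : ∀ a, q.coeff a ≠ 0 → ∀ i, a i < p)
    (hdet : ∀ a, IsDeterminedBy (S : Set (V → ZMod p)) (q.coeff a))
    (heval : eval y q ∈ polyLE (ZMod p) V (e - 1)) :
    WeightedLE (polyLE (ZMod p) V) n (e - 1) q := by
  classical
  induction E generalizing k e S q with
  | zero =>
    intro a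
    rw [eq_zero_of_mem_polyLE _ (hq a)]
    · exact zero_mem _
    · have : 0 ≤ n * (a.degree : ℕ) := by positivity
      push_cast at he
      omega
  | succ E ih =>
    -- The induction hypothesis for `formalDiff h y q`, which has weight at most `e - 1` and
    -- evaluates to degree at most `e - 2`.
    have hD : ∀ (h : V) (b : σ →₀ ℕ), fwdDiff h (q.coeff b) +
        ∑ i, q.coeff (b + Finsupp.single i 1) * (b i + 1) * fwdDiff h (y i) ∈
          polyLE (ZMod p) V (e - 2 - n * (b.degree : ℕ)) := fun h b => by
      rw [← coeff_formalDiff, show e - 2 = e - 1 - 1 by ring]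
      refine ih (2 * k + Fintype.card σ) ?_ (by push_cast at he; omega)
        (S := S ∪ S.image (shiftHom h) ∪ Finset.univ.image fun i => fwdDiff h (y i)) ?_ ?_
        (hq.formalDiff hy h) (coeff_formalDiff_of_reduced hred h) ?_ ?_ b
      -- The factor 3 absorbs the growth: `(2k + |σ|) + 1 + |σ| ≤ 3 (k + 1 + |σ|)`.
      · refine le_trans ?_ hE
        rw [pow_succ, mul_comm (3 ^ E) 3, ← mul_assoc]
        exact Nat.mul_le_mul_right _ (by omega)
      · have h1 := Finset.card_union_le (S ∪ S.image (shiftHom h))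
          (Finset.univ.image fun i => fwdDiff h (y i))
        have h2 := Finset.card_union_le S (S.image (shiftHom h))
        have h3 := Finset.card_image_le (s := S) (f := shiftHom h)
        have h4 := Finset.card_image_le (s := Finset.univ) (f := fun i => fwdDiff h (y i))
        rw [Finset.card_univ] at h4
        omega
      · intro g hg
        simp only [Finset.mem_union, Finset.mem_image, Finset.mem_univ, true_and] at hg
        rcases hg with (hg | ⟨g, hg, rfl⟩) | ⟨i, rfl⟩
        · exact hS g hg
        · exact shiftHom_mem_polyLE (hS g hg) h
        · exact fwdDiff_mem_polyLE (hy i) h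
      · intro a
        simpa [Set.union_assoc] using isDeterminedBy_coeff_formalDiff (y := y) hdet h a
      · have h1 := fwdDiff_eval_sub_mem hy hq h
        have h2 := fwdDiff_mem_polyLE heval h
        have h3 := sub_mem (polyLE_mono (show e - 1 - 1 ≤ e - 2 by omega) h2) h1
        rw [sub_sub_cancel] at h3
        exact polyLE_mono (by omega) h3
    by_contra hbad
    obtain ⟨b, hb, hmax⟩ : ∃ b, q.coeff b ∉ polyLE (ZMod p) V (e - 1 - n * (b.degree : ℕ)) ∧
        ∀ a, b.degree < a.degree →
          q.coeff a ∈ polyLE (ZMod p) V (e - 1 - n * (a.degree : ℕ)) := by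
      let B := q.support.filter fun a =>
        q.coeff a ∉ polyLE (ZMod p) V (e - 1 - n * (a.degree : ℕ))
      have hB : ∀ a, a ∈ B ↔ q.coeff a ∉ polyLE (ZMod p) V (e - 1 - n * (a.degree : ℕ)) :=
        fun a => by
          simp only [B, Finset.mem_filter, and_iff_right_iff_imp, mem_support_iff]
          exact fun h h0 => h (h0 ▸ zero_mem _)
      have hne : B.Nonempty := by
        simp only [WeightedLE, not_forall] at hbad
        obtain ⟨a, ha⟩ := hbad
        exact ⟨a, (hB a).2 ha⟩
      obtain ⟨b, hb, hmax⟩ := B.exists_max_image Finsupp.degree hne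
      refine ⟨b, (hB b).1 hb, fun a hab => ?_⟩
      by_contra ha
      exact absurd (hmax a ((hB a).2 ha)) (by omega)
    have hcast : ∀ (b : σ →₀ ℕ) (i : σ), ((b i : V → ZMod p) + 1) ∈ polyLE (ZMod p) V 0 :=
      fun b i => by
        convert const_mem_polyLE (V := V) le_rfl ((b i : ZMod p) + 1) using 1
        ext; simp
    have hb0 : q.coeff b ≠ 0 := fun h0 => hb (h0 ▸ zero_mem _)
    rcases lt_trichotomy (e - n * (b.degree : ℕ)) 0 with hlt | heq | hgt
    · exact hb0 (eq_zero_of_mem_polyLE hlt (hq b))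
    -- Here `q.coeff b` is constant. If `b = 0`, then `e = 0`, `q` is a constant polynomial, and its
    -- value has negative degree.
    · rcases Nat.eq_zero_or_pos b.degree with hdeg | hdeg
      · have hbz : b = 0 := (Finsupp.degree_eq_zero_iff _).1 hdeg
        have he0 : e = 0 := by rw [hdeg] at heq; simpa using heq
        have hq0 : ∀ a, a ≠ 0 → q.coeff a = 0 := fun a ha => by
          have h1 := hq a
          have h2 : 1 ≤ a.degree := Nat.one_le_iff_ne_zero.2 (mt (Finsupp.degree_eq_zero_iff a).1 ha)
          refine eq_zero_of_mem_polyLE ?_ h1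
          have : (0 : ℤ) < n * (a.degree : ℕ) := by positivity
          omega
        have hqC : q = C (q.coeff 0) := by
          ext1 a
          rw [coeff_C]
          split_ifs with h
          · rw [← h]
          · exact hq0 a (Ne.symm h)
        rw [hqC, eval_C] at heval
        exact hb0 (hbz ▸ eq_zero_of_mem_polyLE (by omega) heval)
      · obtain ⟨i₀, hi₀⟩ : ∃ i, b i ≠ 0 := by
          by_contra! h
          have : b = 0 := Finsupp.ext h
          simp [this] at hdeg
        let b' := b - Finsupp.single i₀ 1
        have hbb' : b' + Finsupp.single i₀ 1 = b :=
          tsub_add_cancel_of_le (Finsupp.single_le_iff.2 (Nat.one_le_iff_ne_zero.2 hi₀))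
        have hdeg' : b'.degree + 1 = b.degree := by
          rw [← hbb', map_add, Finsupp.degree_single]
        have hconst : ∀ i, q.coeff (b' + Finsupp.single i 1) * (b' i + 1) ∈
            polyLE (ZMod p) V 0 := fun i => by
          have h1 := hq (b' + Finsupp.single i 1)
          rw [map_add, Finsupp.degree_single, hdeg', heq] at h1
          simpa using mul_mem_polyLE h1 (hcast b' i)
        let c : σ → ZMod p := fun i => (q.coeff (b' + Finsupp.single i 1) * (b' i + 1)) 0
        have hc : ∀ i, q.coeff (b' + Finsupp.single i 1) * ((b' i : V → ZMod p) + 1) =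
            fun _ => c i := fun i => funext fun x => eq_const_of_mem_polyLE_zero (hconst i) x
        have hdeg2 : e - 2 - n * (b'.degree : ℕ) = n - 1 - 1 := by
          have : (b.degree : ℤ) = b'.degree + 1 := by exact_mod_cast hdeg'.symm
          rw [this] at heq
          linarith
        -- By `hD` at `b'`, every derivative of `g` has degree at most `n - 2`.
        let g := q.coeff b' + ∑ i, c i • y i
        have hg : g ∈ polyLE (ZMod p) V (n - 1) := by
          refine mem_polyLE_of_fwdDiff (by omega) fun h => ?_
          have h1 := hD h b'
          rw [hdeg2] at h1
          convert h1 using 1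
          simp only [g, fwdDiff_add, fwdDiff_finsetSum, fwdDiff_const_smul, hc]
          rfl
        -- `c i₀` is the constant `q.coeff b` times `b i₀`, and `0 < b i₀ < p` makes the latter
        -- nonzero modulo `p`; this is where reducedness is needed.
        have hc0 : c ≠ 0 := fun h0 => by
          have h1 := congrFun h0 i₀
          have h2 : b' i₀ + 1 = b i₀ := by rw [← hbb']; simp
          have h3 : c i₀ = q.coeff b 0 * (b i₀ : ℕ) := by
            simp only [c, hbb', Pi.mul_apply, ← h2]
            simp
          rw [h3] at h1
          rcases mul_eq_zero.1 h1 with h4 | h4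
          · refine hb0 (funext fun x => ?_)
            have h5 := hq b
            rw [heq] at h5
            rw [eq_const_of_mem_polyLE_zero h5 x, h4]; rfl
          · rw [ZMod.natCast_eq_zero_iff] at h4
            exact absurd (Nat.le_of_dvd (Nat.pos_of_ne_zero hi₀) h4) (by
              have := hred b hb0 i₀; omega)
        -- `∑ c i • y i = g - q.coeff b'` depends only on `g` and `S`, at most `k + 1` functions of
        -- degree at most `n - 1`.
        have h1 := hL c hc0 (insert g S) (fun f hf => by
          rcases Finset.mem_insert.1 hf with rfl | hf
          · exact hg
          · exact hS f hf) (by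
          have : ∑ i, c i • y i = g - q.coeff b' := by simp [g]
          rw [this, Finset.coe_insert]
          exact (isDeterminedBy_of_mem (Set.mem_insert _ _)).sub
            ((hdet b').mono (Set.subset_insert _ _)))
        have h2 := Finset.card_insert_le g S
        have h3 : k + 1 + Fintype.card σ ≤ (k + 1 + Fintype.card σ) * 3 ^ (E + 1) :=
          Nat.le_mul_of_pos_right _ (by positivity)
        omega
    -- By maximality of `b`, the coefficients at `b + single i 1` are good, so `hD` bounds the
    -- derivative of `q.coeff b` itself.
    · refine hb (mem_polyLE_of_fwdDiff (by omega) fun h => ?_)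
      have h1 := hD h b
      have h2 : ∑ i, q.coeff (b + Finsupp.single i 1) * (b i + 1) * fwdDiff h (y i) ∈
          polyLE (ZMod p) V (e - 2 - n * (b.degree : ℕ)) := sum_mem fun i _ => by
        have h3 := hmax (b + Finsupp.single i 1) (by simp)
        refine polyLE_mono (le_of_eq ?_)
          (mul_mem_polyLE (mul_mem_polyLE h3 (hcast b i)) (fwdDiff_mem_polyLE (hy i) h))
        rw [map_add, Finsupp.degree_single]
        push_cast
        ring
      refine polyLE_mono (by omega) ((add_mem_cancel_right h2).1 h1)

end Regular

theorem degreeRank_le {p n d : ℕ} {P : (Fin n → ZMod p) → ZMod p}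
    {S : Finset ((Fin n → ZMod p) → ZMod p)} (hS : ∀ g ∈ S, IsPolyOfDegreeLE d g)
    (hP : IsDeterminedBy (S : Set ((Fin n → ZMod p) → ZMod p)) P) :
    degreeRank d P ≤ S.card := by
  refine iInf₂_le_of_le S.card ?_ le_rfl
  let Q : Fin S.card → (Fin n → ZMod p) → ZMod p := fun j => (S.equivFin.symm j).1
  refine ⟨Q, Function.extend (fun x j => Q j x) P fun _ => 0, fun j => hS _ (S.equivFin.symm j).2,
    fun x => (Function.FactorsThrough.extend_apply (fun x x' hx => hP x x' fun g hg => ?_) _ x).symm⟩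
  simpa [Q] using congrFun hx (S.equivFin ⟨g, hg⟩)

/-! ### Induction over the degrees of the factor. -/

namespace PolyFactor

variable {p n d : ℕ}

theorem IsMonomial.one (𝓕 : PolyFactor p n d) : 𝓕.IsMonomial 0 1 :=
  ⟨0, Fin.elim0, Fin.elim0, fun j => j.elim0, by simp, by simp⟩

theorem IsMonomial.mul_poly {𝓕 : PolyFactor p n d} {e : ℕ} {g : (Fin n → ZMod p) → ZMod p}
    (hg : 𝓕.IsMonomial e g) (i : Fin d) (j : Fin (𝓕.M i)) :
    𝓕.IsMonomial (e + (i + 1)) (g * 𝓕.poly i j) := by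
  obtain ⟨J, δ, Q, hQ, rfl, rfl⟩ := hg
  refine ⟨J + 1, Fin.snoc (α := fun _ => Fin d) δ i,
    Fin.snoc (α := fun _ => (Fin n → ZMod p) → ZMod p) Q (𝓕.poly i j), fun k => ?_, ?_, ?_⟩
  · refine Fin.lastCases ?_ (fun k => ?_) k
    · rw [Fin.snoc_last, Fin.snoc_last]
      exact Submodule.subset_span ⟨j, rfl⟩
    · rw [Fin.snoc_castSucc, Fin.snoc_castSucc]
      exact hQ k
  · simp [Fin.prod_univ_castSucc]
  · simp [Fin.sum_univ_castSucc]

/-- The functions of `𝓕`-degree at most `D`, for an integer `D`. -/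
def factorDegreeLE (𝓕 : PolyFactor p n d) (D : ℤ) :
    Submodule (ZMod p) ((Fin n → ZMod p) → ZMod p) :=
  Submodule.span (ZMod p) {g | ∃ e : ℕ, (e : ℤ) ≤ D ∧ 𝓕.IsMonomial e g}

theorem mul_poly_mem_factorDegreeLE {𝓕 : PolyFactor p n d} {D : ℤ}
    {f : (Fin n → ZMod p) → ZMod p} (hf : f ∈ 𝓕.factorDegreeLE D) (i : Fin d) (j : Fin (𝓕.M i)) :
    f * 𝓕.poly i j ∈ 𝓕.factorDegreeLE (D + ((i : ℕ) + 1 : ℕ)) := by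
  induction hf using Submodule.span_induction with
  | mem g hg =>
    obtain ⟨e, he, hg⟩ := hg
    exact Submodule.subset_span ⟨_, by push_cast; omega, hg.mul_poly i j⟩
  | zero => simp
  | add f g _ _ hf hg => rw [add_mul]; exact add_mem hf hg
  | smul c f _ hf => rw [smul_mul_assoc]; exact Submodule.smul_mem _ c hf

open Classical in
/-- The polynomials `P_{i,j}` of the factor with index `i < m`. -/
noncomputable def lowerPolys (𝓕 : PolyFactor p n d) (m : ℕ) :
    Finset ((Fin n → ZMod p) → ZMod p) :=
  (Finset.univ.filter fun k : Σ i, Fin (𝓕.M i) => (k.1 : ℕ) < m).image fun k => 𝓕.poly k.1 k.2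

theorem mem_lowerPolys {𝓕 : PolyFactor p n d} {m : ℕ} {g : (Fin n → ZMod p) → ZMod p} :
    g ∈ 𝓕.lowerPolys m ↔ ∃ (i : Fin d) (j : Fin (𝓕.M i)), (i : ℕ) < m ∧ 𝓕.poly i j = g := by
  classical
  simp [lowerPolys, Sigma.exists]

theorem card_lowerPolys_le (𝓕 : PolyFactor p n d) (m : ℕ) : (𝓕.lowerPolys m).card ≤ 𝓕.dim := by
  classical
  refine Finset.card_image_le.trans ((Finset.card_filter_le _ _).trans (le_of_eq ?_))
  simp [dim]

theorem lowerPolys_subset_polyLE {𝓕 : PolyFactor p n d} {m : ℕ} {g : (Fin n → ZMod p) → ZMod p}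
    (hg : g ∈ 𝓕.lowerPolys m) : g ∈ polyLE (ZMod p) (Fin n → ZMod p) m := by
  obtain ⟨i, j, him, rfl⟩ := mem_lowerPolys.1 hg
  exact polyLE_mono (by exact_mod_cast him) (isPolyOfDegreeLE_iff.1 (𝓕.degree_le i j))

theorem lowerPolys_succ (𝓕 : PolyFactor p n d) (m : Fin d) :
    (𝓕.lowerPolys (m + 1) : Set ((Fin n → ZMod p) → ZMod p)) ⊆
      𝓕.lowerPolys m ∪ Set.range (𝓕.poly m) := by
  intro g hg
  obtain ⟨i, j, him, rfl⟩ := mem_lowerPolys.1 hg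
  rcases Nat.lt_succ_iff_lt_or_eq.1 him with h | h
  · exact Or.inl (mem_lowerPolys.2 ⟨i, j, h, rfl⟩)
  · obtain rfl := Fin.ext h
    exact Or.inr ⟨j, rfl⟩

/-- An upper bound for the degree of a function of the polynomials of a factor of dimension `N`. -/
def degreeBound (p d N : ℕ) : ℕ := 2 * (d * (N * (p - 1)))

/-- A growth function for which degree and `𝓕`-degree agree. -/
def growth (p d N : ℕ) : ℕ := (N + 1 + N) * 3 ^ (degreeBound p d N + 1) + 1

theorem monotone_growth (p d : ℕ) : Monotone (growth p d) := fun a b hab => by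
  unfold growth degreeBound
  gcongr
  norm_num

theorem IsRegular.growth_le_card {𝓕 : PolyFactor p n d}
    (h𝓕 : 𝓕.IsRegular fun N => (growth p d N : ℝ≥0)) (i : Fin d) {c : Fin (𝓕.M i) → ZMod p}
    (hc : c ≠ 0) {S : Finset ((Fin n → ZMod p) → ZMod p)}
    (hS : ∀ g ∈ S, g ∈ polyLE (ZMod p) (Fin n → ZMod p) (i : ℕ))
    (hdet : IsDeterminedBy (S : Set ((Fin n → ZMod p) → ZMod p)) (∑ j, c j • 𝓕.poly i j)) :
    growth p d 𝓕.dim ≤ S.card := by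
  have h1 := h𝓕 i c hc
  have h2 := degreeRank_le (fun g hg => isPolyOfDegreeLE_iff.2 (hS g hg)) hdet
  have h3 := h1.trans (ENat.toENNReal_mono h2)
  simpa using h3

theorem mem_factorDegreeLE [Fact p.Prime] {𝓕 : PolyFactor p n d}
    (h𝓕 : 𝓕.IsRegular fun N => (growth p d N : ℝ≥0)) {m : ℕ} (hm : m ≤ d) {D : ℤ}
    {f : (Fin n → ZMod p) → ZMod p} (hf : f ∈ polyLE (ZMod p) (Fin n → ZMod p) D)
    (hdet : IsDeterminedBy (𝓕.lowerPolys m : Set ((Fin n → ZMod p) → ZMod p)) f) :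
    f ∈ 𝓕.factorDegreeLE D := by
  induction m generalizing f D with
  | zero =>
    rcases lt_or_ge D 0 with hD | hD
    · rw [eq_zero_of_mem_polyLE hD hf]; exact zero_mem _
    · have h1 : f = f 0 • 1 := by
        ext x
        have := hdet x 0 (fun g hg => by
          obtain ⟨i, j, him, -⟩ := mem_lowerPolys.1 hg
          omega)
        simpa using this
      rw [h1]
      exact Submodule.smul_mem _ _ (Submodule.subset_span ⟨0, hD, IsMonomial.one 𝓕⟩)
  | succ m ih =>
    -- Index `m` stands for degree `k = m + 1`, while `lowerPolys m` has degrees at most `m`.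
    let i : Fin d := ⟨m, hm⟩
    let k : ℕ := m + 1
    have hk : (k : ℤ) = m + 1 := by simp [k]
    let S := 𝓕.lowerPolys m
    have hy : ∀ j, 𝓕.poly i j ∈ polyLE (ZMod p) (Fin n → ZMod p) k := fun j =>
      isPolyOfDegreeLE_iff.1 (𝓕.degree_le i j)
    obtain ⟨q, rfl, hqdet, hred⟩ := exists_reduced_eval_eq (hdet.mono (𝓕.lowerPolys_succ i))
    rw [ZMod.card] at hred
    have hMi : Fintype.card (Fin (𝓕.M i)) ≤ 𝓕.dim := by
      rw [Fintype.card_fin]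
      exact Finset.single_le_sum (f := 𝓕.M) (fun _ _ => Nat.zero_le _) (Finset.mem_univ i)
    have hS : ∀ g ∈ S, g ∈ polyLE (ZMod p) (Fin n → ZMod p) m := fun g hg =>
      lowerPolys_subset_polyLE hg
    -- A priori bound: exponents and coefficients each contribute at most `d * (dim * (p - 1))`,
    -- whence the 2 in `degreeBound`.
    have hbase : WeightedLE (polyLE (ZMod p) (Fin n → ZMod p)) k (degreeBound p d 𝓕.dim) q := by
      intro a
      by_cases ha : q.coeff a = 0
      · rw [ha]; exact zero_mem _
      have h1 : q.coeff a ∈ polyLE (ZMod p) (Fin n → ZMod p)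
          (m * (Fintype.card S * (Fintype.card (ZMod p) - 1) : ℕ)) :=
        mem_polyLE_of_isDeterminedBy (fun g : S => hS g.1 g.2) (by simpa using hqdet a)
      refine polyLE_mono ?_ h1
      have h2 : k * a.degree ≤ d * (𝓕.dim * (p - 1)) :=
        Nat.mul_le_mul hm ((degree_le_of_forall_lt (hred a ha)).trans (Nat.mul_le_mul_right _ hMi))
      have h3 : m * (Fintype.card S * (Fintype.card (ZMod p) - 1)) ≤ d * (𝓕.dim * (p - 1)) := by
        rw [ZMod.card, Fintype.card_coe]
        exact Nat.mul_le_mul (by omega) (Nat.mul_le_mul_right _ (𝓕.card_lowerPolys_le m))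
      have h4 : k * a.degree + m * (Fintype.card S * (Fintype.card (ZMod p) - 1)) ≤
        degreeBound p d 𝓕.dim := by unfold degreeBound; omega
      zify at h4
      push_cast
      linarith
    have hdesc : ∀ t : ℕ, D + t ≤ degreeBound p d 𝓕.dim →
        WeightedLE (polyLE (ZMod p) (Fin n → ZMod p)) k (D + t) q →
        WeightedLE (polyLE (ZMod p) (Fin n → ZMod p)) k D q := by
      intro t
      induction t with
      | zero => intro _ h; simpa using h
      | succ t iht =>
        intro ht h
        push_cast at ht h
        refine iht (by omega) ?_
        -- `L` is `growth - 1`, since the rank condition there is strict; `E` is one more than the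
        -- largest weight met in the descent.
        have := weightedLE_of_eval_mem (by omega) hy
          (L := (𝓕.dim + 1 + 𝓕.dim) * 3 ^ (degreeBound p d 𝓕.dim + 1))
          (fun c hc S hS hdet => h𝓕.growth_le_card i hc (fun g hg => by
            have := hS g hg
            rwa [hk, add_sub_cancel_right] at this) hdet)
          (degreeBound p d 𝓕.dim + 1) 𝓕.dim (Nat.mul_le_mul_right _ (by omega))
          (by push_cast; omega) (𝓕.card_lowerPolys_le m)
          (fun g hg => by rw [hk, add_sub_cancel_right]; exact hS g hg) h hred hqdet
          (polyLE_mono (by omega) hf)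
        convert this using 1
        ring
    have hq : WeightedLE (polyLE (ZMod p) (Fin n → ZMod p)) k D q := by
      rcases le_total (degreeBound p d 𝓕.dim : ℤ) D with h | h
      · exact hbase.mono polyLE_mono h
      · obtain ⟨t, ht⟩ := Int.le.dest h
        exact hdesc t ht.le (ht ▸ hbase)
    -- Each coefficient has `𝓕`-degree at most `D - k|a|` by induction, and each factor `y j` adds
    -- `k`.
    exact WeightedLE.eval_mem (U := 𝓕.factorDegreeLE) (n := k)
      (fun e f j hf => mul_poly_mem_factorDegreeLE hf i j)
      fun a => ih (by omega) (hq a) (hqdet a)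

end PolyFactor

theorem mainTheorem6 (p : ℕ) [Fact p.Prime] (d D : ℕ) (hd : d < p) (hD : D < p) :
    ∃ F : ℕ → ℝ≥0, Monotone F ∧
      ∀ (n : ℕ) (𝓕 : PolyFactor p n d) (P : (Fin n → ZMod p) → ZMod p),
        𝓕.IsRegular F →
        IsPolyOfDegreeLE D P →
        @Measurable _ _ 𝓕.sigmaAlgebra ⊤ P →
        𝓕.HasFactorDegreeLE D P := by
  refine ⟨fun N => (PolyFactor.growth p d N : ℝ≥0),
    Nat.mono_cast.comp (PolyFactor.monotone_growth p d), fun n 𝓕 P h𝓕 hP hmeas => ?_⟩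
  have h := PolyFactor.mem_factorDegreeLE h𝓕 le_rfl (isPolyOfDegreeLE_iff.1 hP)
    fun x x' hx => (𝓕.measurable_iff P).1 hmeas x x' <| funext fun i => funext fun j =>
      hx _ (PolyFactor.mem_lowerPolys.2 ⟨i, j, i.2, rfl⟩)
  simpa only [PolyFactor.HasFactorDegreeLE, PolyFactor.factorDegreeLE, Nat.cast_le] using h
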